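/- All Banach spaces are over one fixed scalar field $\mathbb K=\mathbb R$ or $\mathbb C$. For Banach spaces $X,Y$, let $L(X,Y)$ be the space of bounded linear operators, $K(X,Y)$ its closed subspace of compact operators, and $C(X,Y)=L(X,Y)/K(X,Y)$; $N(\cdot)$ and $R(\cdot)$ denote null space and range. An operator $S\in L(X,Y)$ is *regular* if there is $S'\in L(Y,X)$ with $S=SS'S$; any such $S'$ is called a *generalized inverse* for $S$. For $S\in L(X,Y)$ and $T\in L(Y,X)$, the pair $(S,T)$ is a *Fredholm pair* if the four spaces $$N(S)/(N(S)\cap R(T)),\quad R(T)/(N(S)\cap R(T)),\quad N(T)/(N(T)\cap R(S)),\quad R(S)/(N(T)\cap R(S))$$ are finite dimensional, and a *regular Fredholm pair* if moreover $S$ and $T$ are regular. For a Banach space $Z$ and $A\in L(X,Y)$ (and likewise for operators from $Y$ to $X$), let $\tilde L_A\colon C(Z,X)\to C(Z,Y)$ and $\tilde R_A\colon C(Y,Z)\to C(X,Z)$ be the bounded operators induced by $V\mapsto AV$ and $W\mapsto WA$ respectively. **Theorem 5.5.** Let $X,Y$ be Banach spaces, let $S\in L(X,Y)$ and $T\in L(Y,X)$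 be regular operators such that $R(ST)$ and $R(TS)$ are finite dimensional, and let $S'\in L(Y,X)$ and $T'\in L(X,Y)$ be any generalized inverses for $S$ and $T$ respectively. Then $(S,T)$ is a regular Fredholm pair if and only if, for every Banach space $Z$, the operators $$\tilde L_{S'}\tilde L_S+\tilde L_T\tilde L_{T'}\in L(C(Z,X))\quad\text{and}\quad \tilde L_{T'}\tilde L_T+\tilde L_S\tilde L_{S'}\in L(C(Z,Y))$$ are both invertible. Similarly, $(S,T)$ is a regular Fredholm pair if and only if, for every Banach space $Z$, the operators $$\tilde R_{S'}\tilde R_S+\tilde R_T\tilde R_{T'}\in L(C(Y,Z))\quad\text{and}\quad \tilde R_{T'}\tilde R_T+\tilde R_S\tilde R_{S'}\in L(C(X,Z))$$ are both invertible. -/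

import Mathlib

universe u v w

namespace FredholmPairs

section Pairs

variable {𝕜 X Y : Type*} [RCLike 𝕜]
  [NormedAddCommGroup X] [NormedSpace 𝕜 X] [NormedAddCommGroup Y] [NormedSpace 𝕜 Y]

/-- `S'` is a generalized inverse (pseudo inverse) for `S`: `S = S S' S`. -/
def IsGeneralizedInverse (S' : Y →L[𝕜] X) (S : X →L[𝕜] Y) : Prop :=
  S = S ∘L S' ∘L S

/-- `S` is regular (relatively Fredholm): it has a bounded generalized inverse. -/
def IsRegularOperator (S : X →L[𝕜] Y) : Prop :=
  ∃ S' : Y →L[𝕜] X, IsGeneralizedInverse S' S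

/-- The dimension of `A / (A ∩ B)` is finite, for subspaces `A`, `B` of the same space. -/
def FiniteDimQuotInf (A B : Submodule 𝕜 X) : Prop :=
  FiniteDimensional 𝕜 (A ⧸ (A ⊓ B).submoduleOf A)

/-- `(S, T)` is a Fredholm pair: the four quotients `N(S)/(N(S) ∩ R(T))`, `R(T)/(N(S) ∩ R(T))`,
`N(T)/(N(T) ∩ R(S))` and `R(S)/(N(T) ∩ R(S))` are finite dimensional. -/
structure IsFredholmPair (S : X →L[𝕜] Y) (T : Y →L[𝕜] X) : Prop where
  finite_a : FiniteDimQuotInf S.ker T.range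
  finite_b : FiniteDimQuotInf T.range S.ker
  finite_c : FiniteDimQuotInf T.ker S.range
  finite_d : FiniteDimQuotInf S.range T.ker

/-- `(S, T)` is a regular Fredholm pair: a Fredholm pair whose two operators are regular. -/
structure IsRegularFredholmPair (S : X →L[𝕜] Y) (T : Y →L[𝕜] X) : Prop where
  isFredholmPair : IsFredholmPair S T
  regular_left : IsRegularOperator S
  regular_right : IsRegularOperator T

end Pairs

section Multiplication

variable {𝕜 X Y : Type*} [RCLike 𝕜]
  [NormedAddCommGroup X] [NormedSpace 𝕜 X] [NormedAddCommGroup Y] [NormedSpace 𝕜 Y]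

/-- `C(Z, X) = L(Z, X) / K(Z, X)`: bounded operators modulo compact operators, with the quotient
topology of the operator norm. -/
abbrev Calkin (𝕜 Z X : Type*) [RCLike 𝕜] [NormedAddCommGroup Z] [NormedSpace 𝕜 Z]
    [NormedAddCommGroup X] [NormedSpace 𝕜 X] : Type _ :=
  (Z →L[𝕜] X) ⧸ compactOperator (RingHom.id 𝕜) Z X

/-- The left multiplication operator `L_S : L(Z, X) → L(Z, Y)`, `V ↦ S V`. -/
noncomputable def leftMul (Z : Type*) [NormedAddCommGroup Z] [NormedSpace 𝕜 Z]
    (S : X →L[𝕜] Y) : (Z →L[𝕜] X) →L[𝕜] (Z →L[𝕜] Y) :=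
  ContinuousLinearMap.compL 𝕜 Z X Y S

/-- The right multiplication operator `R_S : L(Y, Z) → L(X, Z)`, `W ↦ W S`. -/
noncomputable def rightMul (Z : Type*) [NormedAddCommGroup Z] [NormedSpace 𝕜 Z]
    (S : X →L[𝕜] Y) : (Y →L[𝕜] Z) →L[𝕜] (X →L[𝕜] Z) :=
  (ContinuousLinearMap.compL 𝕜 X Y Z).flip S

theorem leftMul_mem_compact (Z : Type*) [NormedAddCommGroup Z] [NormedSpace 𝕜 Z]
    (S : X →L[𝕜] Y) :
    compactOperator (RingHom.id 𝕜) Z X ≤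
      ((compactOperator (RingHom.id 𝕜) Z Y).mkQL ∘L leftMul Z S).ker := by
  intro V hV
  have h : leftMul Z S V ∈ compactOperator (RingHom.id 𝕜) Z Y :=
    IsCompactOperator.clm_comp hV S
  simpa using h

theorem rightMul_mem_compact (Z : Type*) [NormedAddCommGroup Z] [NormedSpace 𝕜 Z]
    (S : X →L[𝕜] Y) :
    compactOperator (RingHom.id 𝕜) Y Z ≤
      ((compactOperator (RingHom.id 𝕜) X Z).mkQL ∘L rightMul Z S).ker := by
  intro W hW
  have h : rightMul Z S W ∈ compactOperator (RingHom.id 𝕜) X Z :=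
    IsCompactOperator.comp_clm hW S
  simpa using h

/-- The factorization `C(Z, X) → C(Z, Y)` of the left multiplication operator by `S`. -/
noncomputable def calkinLeft (Z : Type*) [NormedAddCommGroup Z] [NormedSpace 𝕜 Z]
    (S : X →L[𝕜] Y) : Calkin 𝕜 Z X →L[𝕜] Calkin 𝕜 Z Y :=
  (compactOperator (RingHom.id 𝕜) Z X).liftQL
    ((compactOperator (RingHom.id 𝕜) Z Y).mkQL ∘L leftMul Z S) (leftMul_mem_compact Z S)

/-- The factorization `C(Y, Z) → C(X, Z)` of the right multiplication operator by `S`. -/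
noncomputable def calkinRight (Z : Type*) [NormedAddCommGroup Z] [NormedSpace 𝕜 Z]
    (S : X →L[𝕜] Y) : Calkin 𝕜 Y Z →L[𝕜] Calkin 𝕜 X Z :=
  (compactOperator (RingHom.id 𝕜) Y Z).liftQL
    ((compactOperator (RingHom.id 𝕜) X Z).mkQL ∘L rightMul Z S) (rightMul_mem_compact Z S)

end Multiplication

end FredholmPairs

namespace FredholmPairs

/-! ### Compactness, finite rank and quotients. -/

section Compactness

variable {𝕜 E F G : Type*} [RCLike 𝕜]
  [NormedAddCommGroup E] [NormedSpace 𝕜 E] [NormedAddCommGroup F] [NormedSpace 𝕜 F]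
  [NormedAddCommGroup G] [NormedSpace 𝕜 G]

/-! On `X` put `P = S'S` and `Q = TT'`. These are idempotents with `N(S) = R(1 - P)`, `R(T) = N(1 -
Q)`, and `PQ` has finite rank because `ST` does. Hence `N(S)/(N(S) ∩ R(T))` is isomorphic to `R(M)`
for `M = (1 - Q)(1 - P)`, and `R(T)/(N(S) ∩ R(T))`, isomorphic to `R(ST)`, is automatically finite
dimensional. Since `M² - M = (1 - Q)PQ(1 - P)` has finite rank, `M` has finite rank as soon as it is
compact. Modulo compacts, `M` vanishes iff `P + Q` is invertible: the inverse is `1 - QP`, and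
conversely a one-sided inverse suffices. Invertibility of multiplication by `P + Q` on the Calkin
spaces gives such an inverse by taking `Z` to be a copy of `X`. The same argument with `S` and `T`
exchanged handles `Y`. -/

theorem comp_mem_compactOperator {A : E →L[𝕜] F} (hA : A ∈ compactOperator (RingHom.id 𝕜) E F)
    (B : F →L[𝕜] G) : B ∘L A ∈ compactOperator (RingHom.id 𝕜) E G :=
  IsCompactOperator.clm_comp hA B

theorem mem_compactOperator_comp {B : F →L[𝕜] G} (hB : B ∈ compactOperator (RingHom.id 𝕜) F G)
    (A : E →L[𝕜] F) : B ∘L A ∈ compactOperator (RingHom.id 𝕜) E G :=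
  IsCompactOperator.comp_clm hB A

/-- Operators of finite rank are compact. -/
theorem mem_compactOperator_of_finiteDimensional_range (A : E →L[𝕜] F)
    [FiniteDimensional 𝕜 A.range] : A ∈ compactOperator (RingHom.id 𝕜) E F := by
  have : LocallyCompactSpace A.range := .of_finiteDimensional_of_complete 𝕜 _
  have h : IsCompactOperator (A.codRestrict A.range fun x => ⟨x, rfl⟩) :=
    isCompactOperator_of_locallyCompactSpace_dom _
  exact h.clm_comp A.range.subtypeL

/-- On this closed kernel `K` acts as the identity, so the identity is compact there and Riesz's
theorem applies. -/
theorem finiteDimensional_ker_one_sub {K : E →L[𝕜] E}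
    (hK : K ∈ compactOperator (RingHom.id 𝕜) E E) : FiniteDimensional 𝕜 (1 - K).ker := by
  have hx : ∀ x : (1 - K).ker, K x = x := fun x => (sub_eq_zero.1 x.2).symm
  have h : IsCompactOperator (K ∘L (1 - K).ker.subtypeL) := hK.comp_clm _
  have h' := h.codRestrict (V := (1 - K).ker) 
    (fun x => by rw [ContinuousLinearMap.comp_apply, Submodule.subtypeL_apply, hx]; exact x.2)
    (1 - K).isClosed_ker
  refine FiniteDimensional.of_isCompactOperator_id (𝕜 := 𝕜) (Eq.mp (congrArg _ ?_) h')
  exact funext fun x => Subtype.ext (hx x)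

/-- A compact operator that is idempotent up to finite rank has finite rank. -/
theorem finiteDimensional_range_of_compact_of_sq_sub {K : E →L[𝕜] E}
    (hK : K ∈ compactOperator (RingHom.id 𝕜) E E) (h : FiniteDimensional 𝕜 (K * K - K).range) :
    FiniteDimensional 𝕜 K.range := by
  -- Rank-nullity for `1 - K` restricted to `R(K)`: the kernel is finite dimensional by compactness,
  -- the image lies in `R(K² - K)`.
  have := finiteDimensional_ker_one_sub hK
  have hr : FiniteDimensional 𝕜 (((1 - K : E →L[𝕜] E) : E →ₗ[𝕜] E).domRestrict K.range).range := by
    refine Submodule.finiteDimensional_of_le (S₂ := (K * K - K).range) ?_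
    rintro _ ⟨⟨_, x, rfl⟩, rfl⟩
    exact ⟨-x, by simp [neg_add_eq_sub]⟩
  have hk : FiniteDimensional 𝕜 (((1 - K : E →L[𝕜] E) : E →ₗ[𝕜] E).domRestrict K.range).ker := by
    rw [LinearMap.ker_domRestrict]
    exact Module.Finite.of_injective
      ((K.range.subtype.restrict fun x hx => hx) :
        (Submodule.comap K.range.subtype (1 - K).ker) →ₗ[𝕜] (1 - K).ker)
      fun x y hxy => Subtype.ext (Subtype.ext (Subtype.ext_iff.1 hxy :))
  have hq := Module.Finite.equiv
    (((1 - K : E →L[𝕜] E) : E →ₗ[𝕜] E).domRestrict K.range).quotKerEquivRange.symm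
  exact Module.Finite.of_submodule_quotient
    (((1 - K : E →L[𝕜] E) : E →ₗ[𝕜] E).domRestrict K.range).ker

theorem finiteDimensional_range_comp_left (A : E →L[𝕜] F) (B : F →L[𝕜] G)
    [FiniteDimensional 𝕜 A.range] : FiniteDimensional 𝕜 (B ∘L A).range := by
  rw [ContinuousLinearMap.toLinearMap_comp, LinearMap.range_comp]
  infer_instance

theorem finiteDimensional_range_comp_right (A : E →L[𝕜] F) (B : F →L[𝕜] G)
    [FiniteDimensional 𝕜 B.range] : FiniteDimensional 𝕜 (B ∘L A).range :=
  Submodule.finiteDimensional_of_le (LinearMap.range_comp_le_range _ _)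

/-- For a linear map `f` with kernel `B`, the quotient `A / (A ∩ B)` is isomorphic to `f(A)`. -/
theorem finiteDimQuotInf_iff_map (A B : Submodule 𝕜 E) (f : E →ₗ[𝕜] F) (hf : f.ker = B) :
    FiniteDimQuotInf A B ↔ FiniteDimensional 𝕜 (A.map f) := by
  have hker : (f.domRestrict A).ker = (A ⊓ B).submoduleOf A := by
    ext x
    simp [LinearMap.ker_domRestrict, Submodule.submoduleOf, ← hf]
  have e := (f.domRestrict A).quotKerEquivRange
  rw [hker, LinearMap.range_domRestrict] at e
  exact ⟨fun h => by have : Module.Finite 𝕜 _ := h; exact Module.Finite.equiv e,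
    fun h => Module.Finite.equiv e.symm⟩

end Compactness

/-! ### Two idempotents with small product. -/

section Idempotents

variable {𝕜 E : Type*} [RCLike 𝕜] [NormedAddCommGroup E] [NormedSpace 𝕜 E] {P Q : E →L[𝕜] E}

theorem finiteDimensional_range_compl_mul_compl_iff (hP : P * P = P) (hQ : Q * Q = Q)
    (hPQ : FiniteDimensional 𝕜 (P * Q).range) :
    FiniteDimensional 𝕜 ((1 - Q) * (1 - P)).range ↔
      (1 - Q) * (1 - P) ∈ compactOperator (RingHom.id 𝕜) E E := by
  refine ⟨fun h => mem_compactOperator_of_finiteDimensional_range _, fun h => ?_⟩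
  refine finiteDimensional_range_of_compact_of_sq_sub h ?_
  have key : (1 - Q) * (1 - P) * ((1 - Q) * (1 - P)) - (1 - Q) * (1 - P) =
      (1 - Q) ∘L ((P * Q) ∘L (1 - P)) := by
    change _ = (1 - Q) * ((P * Q) * (1 - P))
    have h1 : (1 - P) * (1 - P) = 1 - P := by
      simp only [mul_sub, sub_mul, hP, one_mul, mul_one, sub_self, sub_zero]
    have h2 : (1 - Q) * Q = 0 := by rw [sub_mul, one_mul, hQ, sub_self]
    calc _ = (1 - Q) * (((1 - P) * (1 - P)) - Q * (1 - P) + P * Q * (1 - P))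
              - (1 - Q) * (1 - P) := by noncomm_ring
      _ = (1 - Q) * ((P * Q) * (1 - P)) - ((1 - Q) * Q) * (1 - P) := by
        rw [h1]; noncomm_ring
      _ = _ := by rw [h2, zero_mul, sub_zero]
  rw [key]
  have := finiteDimensional_range_comp_right (1 - P) (P * Q)
  exact finiteDimensional_range_comp_left _ _

/-- If `P + Q` has a right inverse modulo compact operators, then `(1 - Q)(1 - P)` is compact. -/
theorem compl_mul_compl_mem_of_add_mul_sub_one_mem (hQ : Q * Q = Q) (hP : P * P = P)
    (hPQ : P * Q ∈ compactOperator (RingHom.id 𝕜) E E) {W : E →L[𝕜] E}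
    (hW : (P + Q) * W - 1 ∈ compactOperator (RingHom.id 𝕜) E E) :
    (1 - Q) * (1 - P) ∈ compactOperator (RingHom.id 𝕜) E E := by
  set k := (P + Q) * W - 1 with hk
  -- Multiplying `(P + Q)W = 1 + k` by `P` gives `PW = P + Pk - PQW`, which eliminates `PW`; the
  -- factor `1 - Q` then kills `QW`.
  have h1 : Q * W - 1 + P = k - P * k + P * Q * W := by
    have : P * k = P * P * W + P * Q * W - P := by rw [hk]; noncomm_ring
    rw [this, hP, hk]; noncomm_ring
  have h2 : (1 - Q) * (1 - P) = -((1 - Q) * (Q * W - 1 + P)) := by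
    have : (1 - Q) * (Q * W - 1 + P) = (Q - Q * Q) * W - (1 - Q) * (1 - P) := by noncomm_ring
    rw [this, hQ]; simp
  rw [h2, h1]
  exact neg_mem (comp_mem_compactOperator (add_mem (sub_mem hW (comp_mem_compactOperator hW P))
    (mem_compactOperator_comp hPQ W)) (1 - Q))

/-- If `P + Q` has a left inverse modulo compact operators, then `(1 - Q)(1 - P)` is compact. -/
theorem compl_mul_compl_mem_of_mul_add_sub_one_mem (hQ : Q * Q = Q) (hP : P * P = P)
    (hPQ : P * Q ∈ compactOperator (RingHom.id 𝕜) E E) {W : E →L[𝕜] E}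
    (hW : W * (P + Q) - 1 ∈ compactOperator (RingHom.id 𝕜) E E) :
    (1 - Q) * (1 - P) ∈ compactOperator (RingHom.id 𝕜) E E := by
  set k := W * (P + Q) - 1 with hk
  have h1 : W * P - 1 + Q = k - k * Q + W * (P * Q) := by
    have : k * Q = W * (P * Q) + W * (Q * Q) - Q := by rw [hk]; noncomm_ring
    rw [this, hQ, hk]; noncomm_ring
  have h2 : (1 - Q) * (1 - P) = -((W * P - 1 + Q) * (1 - P)) := by
    have : (W * P - 1 + Q) * (1 - P) = W * (P - P * P) - (1 - Q) * (1 - P) := by noncomm_ring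
    rw [this, hP]; simp
  rw [h2, h1]
  exact neg_mem (mem_compactOperator_comp (add_mem (sub_mem hW (mem_compactOperator_comp hW Q))
    (comp_mem_compactOperator hPQ W)) (1 - P))

/-- Expanding `(1 - Q)(1 - P) ≡ 0` gives `P + Q - QP ≡ 1` modulo compacts, which suggests `1 - QP`
as the inverse. -/
theorem add_mul_one_sub_sub_one_mem (hQ : Q * Q = Q)
    (hPQ : P * Q ∈ compactOperator (RingHom.id 𝕜) E E)
    (h : (1 - Q) * (1 - P) ∈ compactOperator (RingHom.id 𝕜) E E) :
    (P + Q) * (1 - Q * P) - 1 ∈ compactOperator (RingHom.id 𝕜) E E := by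
  have key : (P + Q) * (1 - Q * P) - 1 = -((1 - Q) * (1 - P)) - (P * Q) * P := by
    have : (P + Q) * (1 - Q * P) - 1 = P + Q - P * Q * P - (Q * Q) * P - 1 := by noncomm_ring
    rw [this, hQ]; noncomm_ring
  rw [key]
  exact sub_mem (neg_mem h) (mem_compactOperator_comp hPQ P)

theorem one_sub_mul_add_sub_one_mem (hP : P * P = P)
    (hPQ : P * Q ∈ compactOperator (RingHom.id 𝕜) E E)
    (h : (1 - Q) * (1 - P) ∈ compactOperator (RingHom.id 𝕜) E E) :
    (1 - Q * P) * (P + Q) - 1 ∈ compactOperator (RingHom.id 𝕜) E E := by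
  have key : (1 - Q * P) * (P + Q) - 1 = -((1 - Q) * (1 - P)) - Q * (P * Q) := by
    have : (1 - Q * P) * (P + Q) - 1 = P + Q - Q * (P * Q) - Q * (P * P) - 1 := by noncomm_ring
    rw [this, hP]; noncomm_ring
  rw [key]
  exact sub_mem (neg_mem h) (comp_mem_compactOperator hPQ Q)

end Idempotents

/-! ### Multiplication operators on Calkin spaces. -/

section Calkin

variable {𝕜 Z A B C : Type*} [RCLike 𝕜] [NormedAddCommGroup Z] [NormedSpace 𝕜 Z]
  [NormedAddCommGroup A] [NormedSpace 𝕜 A] [NormedAddCommGroup B] [NormedSpace 𝕜 B]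
  [NormedAddCommGroup C] [NormedSpace 𝕜 C]

theorem calkinLeft_mk (U : A →L[𝕜] B) (V : Z →L[𝕜] A) :
    calkinLeft Z U (Submodule.Quotient.mk V) = Submodule.Quotient.mk (U ∘L V) := rfl

theorem calkinRight_mk (U : A →L[𝕜] B) (V : B →L[𝕜] Z) :
    calkinRight Z U (Submodule.Quotient.mk V) = Submodule.Quotient.mk (V ∘L U) := rfl

theorem calkinLeft_comp (U : B →L[𝕜] C) (V : A →L[𝕜] B) :
    calkinLeft Z U ∘L calkinLeft Z V = calkinLeft Z (U ∘L V) := by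
  ext x
  induction x using Submodule.Quotient.induction_on
  rfl

theorem calkinRight_comp (U : B →L[𝕜] C) (V : A →L[𝕜] B) :
    calkinRight Z V ∘L calkinRight Z U = calkinRight Z (U ∘L V) := by
  ext x
  induction x using Submodule.Quotient.induction_on
  rfl

theorem calkinLeft_add (U V : A →L[𝕜] B) :
    calkinLeft Z U + calkinLeft Z V = calkinLeft Z (U + V) := by
  ext x
  induction x using Submodule.Quotient.induction_on with | H W
  rw [_root_.add_apply, calkinLeft_mk, calkinLeft_mk, calkinLeft_mk,
    ContinuousLinearMap.add_comp, Submodule.Quotient.mk_add]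

theorem calkinRight_add (U V : A →L[𝕜] B) :
    calkinRight Z U + calkinRight Z V = calkinRight Z (U + V) := by
  ext x
  induction x using Submodule.Quotient.induction_on with | H W
  rw [_root_.add_apply, calkinRight_mk, calkinRight_mk, calkinRight_mk,
    ContinuousLinearMap.comp_add, Submodule.Quotient.mk_add]

theorem calkinLeft_eq_one {U : A →L[𝕜] A} (h : U - 1 ∈ compactOperator (RingHom.id 𝕜) A A) :
    calkinLeft Z U = 1 := by
  ext x
  induction x using Submodule.Quotient.induction_on with | H W
  rw [calkinLeft_mk, one_apply_eq_self, Submodule.Quotient.eq]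
  exact mem_compactOperator_comp h W

theorem calkinRight_eq_one {U : A →L[𝕜] A} (h : U - 1 ∈ compactOperator (RingHom.id 𝕜) A A) :
    calkinRight Z U = 1 := by
  ext x
  induction x using Submodule.Quotient.induction_on with | H W
  rw [calkinRight_mk, one_apply_eq_self, Submodule.Quotient.eq]
  have := comp_mem_compactOperator h W
  rwa [ContinuousLinearMap.comp_sub] at this

theorem isUnit_calkinLeft {U V : A →L[𝕜] A}
    (h₁ : U * V - 1 ∈ compactOperator (RingHom.id 𝕜) A A)
    (h₂ : V * U - 1 ∈ compactOperator (RingHom.id 𝕜) A A) : IsUnit (calkinLeft Z U) :=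
  ⟨⟨calkinLeft Z U, calkinLeft Z V, (calkinLeft_comp U V).trans (calkinLeft_eq_one h₁),
    (calkinLeft_comp V U).trans (calkinLeft_eq_one h₂)⟩, rfl⟩

theorem isUnit_calkinRight {U V : A →L[𝕜] A}
    (h₁ : U * V - 1 ∈ compactOperator (RingHom.id 𝕜) A A)
    (h₂ : V * U - 1 ∈ compactOperator (RingHom.id 𝕜) A A) : IsUnit (calkinRight Z U) :=
  ⟨⟨calkinRight Z U, calkinRight Z V, (calkinRight_comp V U).trans (calkinRight_eq_one h₂),
    (calkinRight_comp U V).trans (calkinRight_eq_one h₁)⟩, rfl⟩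

theorem exists_right_inverse_of_isUnit_calkinLeft (e : Z ≃L[𝕜] A) {U : A →L[𝕜] A}
    (h : IsUnit (calkinLeft Z U)) :
    ∃ W : A →L[𝕜] A, U * W - 1 ∈ compactOperator (RingHom.id 𝕜) A A := by
  obtain ⟨u, hu⟩ := h
  have hx : calkinLeft Z U ((↑u⁻¹ : Calkin 𝕜 Z A →L[𝕜] Calkin 𝕜 Z A)
      -- With `Z` identified with `A`, `e` plays the identity; any lift of its preimage is a right
      -- inverse modulo compacts.
      (Submodule.Quotient.mk (e : Z →L[𝕜] A))) = Submodule.Quotient.mk (e : Z →L[𝕜] A) := by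
    rw [← hu, ← mul_apply_eq_comp, u.mul_inv, one_apply_eq_self]
  generalize (↑u⁻¹ : Calkin 𝕜 Z A →L[𝕜] Calkin 𝕜 Z A)
    (Submodule.Quotient.mk (e : Z →L[𝕜] A)) = x at hx
  induction x using Submodule.Quotient.induction_on with | H V
  rw [calkinLeft_mk, Submodule.Quotient.eq] at hx
  refine ⟨V ∘L (e.symm : A →L[𝕜] Z), ?_⟩
  convert mem_compactOperator_comp hx (e.symm : A →L[𝕜] Z) using 1
  ext a
  simp

theorem exists_left_inverse_of_isUnit_calkinRight (e : A ≃L[𝕜] Z) {U : A →L[𝕜] A}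
    (h : IsUnit (calkinRight Z U)) :
    ∃ W : A →L[𝕜] A, W * U - 1 ∈ compactOperator (RingHom.id 𝕜) A A := by
  obtain ⟨u, hu⟩ := h
  have hx : calkinRight Z U ((↑u⁻¹ : Calkin 𝕜 A Z →L[𝕜] Calkin 𝕜 A Z)
      (Submodule.Quotient.mk (e : A →L[𝕜] Z))) = Submodule.Quotient.mk (e : A →L[𝕜] Z) := by
    rw [← hu, ← mul_apply_eq_comp, u.mul_inv, one_apply_eq_self]
  generalize (↑u⁻¹ : Calkin 𝕜 A Z →L[𝕜] Calkin 𝕜 A Z)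
    (Submodule.Quotient.mk (e : A →L[𝕜] Z)) = x at hx
  induction x using Submodule.Quotient.induction_on with | H V
  rw [calkinRight_mk, Submodule.Quotient.eq] at hx
  refine ⟨(e.symm : Z →L[𝕜] A) ∘L V, ?_⟩
  convert comp_mem_compactOperator hx (e.symm : Z →L[𝕜] A) using 1
  ext a
  simp

end Calkin

/-! ### From Fredholm pairs to idempotents. -/

section Pairs

variable {𝕜 X Y : Type*} [RCLike 𝕜]
  [NormedAddCommGroup X] [NormedSpace 𝕜 X] [NormedAddCommGroup Y] [NormedSpace 𝕜 Y]
  {S : X →L[𝕜] Y} {T : Y →L[𝕜] X} {S' : Y →L[𝕜] X} {T' : X →L[𝕜] Y}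

namespace IsGeneralizedInverse

theorem apply_apply (h : IsGeneralizedInverse S' S) (x : X) : S (S' (S x)) = S x :=
  (DFunLike.congr_fun h x).symm

theorem comp_mul_comp_self (h : IsGeneralizedInverse S' S) :
    (S' ∘L S) * (S' ∘L S) = S' ∘L S := by
  ext x
  simp [h.apply_apply]

theorem comp_mul_comp_self' (h : IsGeneralizedInverse S' S) :
    (S ∘L S') * (S ∘L S') = S ∘L S' := by
  ext x
  simp [h.apply_apply]

theorem range_one_sub (h : IsGeneralizedInverse S' S) : (1 - S' ∘L S).range = S.ker := by
  ext x
  constructor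
  · rintro ⟨y, rfl⟩
    simp [h.apply_apply]
  · intro hx
    have hx : S x = 0 := hx
    exact ⟨x, by simp [hx]⟩

theorem ker_one_sub (h : IsGeneralizedInverse S' S) : (1 - S ∘L S').ker = S.range := by
  ext x
  constructor
  · intro hx
    have hx : x - S (S' x) = 0 := hx
    exact ⟨S' x, (sub_eq_zero.1 hx).symm⟩
  · rintro ⟨y, rfl⟩
    simp [h.apply_apply]

end IsGeneralizedInverse

theorem finiteDimQuotInf_ker_range_iff (hS : IsGeneralizedInverse S' S)
    (hT : IsGeneralizedInverse T' T) :
    FiniteDimQuotInf S.ker T.range ↔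
      FiniteDimensional 𝕜 ((1 - T ∘L T') * (1 - S' ∘L S)).range := by
  rw [finiteDimQuotInf_iff_map _ _ _ hT.ker_one_sub, ← hS.range_one_sub, ← LinearMap.range_comp]
  rfl

theorem finiteDimQuotInf_range_ker (hST : FiniteDimensional 𝕜 (S ∘L T).range) :
    FiniteDimQuotInf T.range S.ker := by
  rw [finiteDimQuotInf_iff_map _ _ _ rfl, ← LinearMap.range_comp]
  exact hST

theorem finiteDimensional_range_mul (hST : FiniteDimensional 𝕜 (S ∘L T).range) :
    FiniteDimensional 𝕜 ((S' ∘L S) * (T ∘L T')).range := by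
  have := finiteDimensional_range_comp_right T' (S ∘L T)
  exact finiteDimensional_range_comp_left ((S ∘L T) ∘L T') S'

/-- For regular `S`, `T` with finite rank products, being a regular Fredholm pair means that the
products of the complementary projections onto `N(S)` and along `R(T)`, and onto `N(T)` and along
`R(S)`, are compact. -/
theorem isRegularFredholmPair_iff_compact (hST : FiniteDimensional 𝕜 (S ∘L T).range)
    (hTS : FiniteDimensional 𝕜 (T ∘L S).range)
    (hS : IsGeneralizedInverse S' S) (hT : IsGeneralizedInverse T' T) :
    IsRegularFredholmPair S T ↔
      (1 - T ∘L T') * (1 - S' ∘L S) ∈ compactOperator (RingHom.id 𝕜) X X ∧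
      (1 - S ∘L S') * (1 - T' ∘L T) ∈ compactOperator (RingHom.id 𝕜) Y Y := by
  rw [← finiteDimensional_range_compl_mul_compl_iff hS.comp_mul_comp_self hT.comp_mul_comp_self'
      (finiteDimensional_range_mul hST),
    ← finiteDimensional_range_compl_mul_compl_iff hT.comp_mul_comp_self hS.comp_mul_comp_self'
      (finiteDimensional_range_mul hTS),
    ← finiteDimQuotInf_ker_range_iff hS hT, ← finiteDimQuotInf_ker_range_iff hT hS]
  exact ⟨fun h => ⟨h.isFredholmPair.finite_a, h.isFredholmPair.finite_c⟩,
    fun h => ⟨⟨h.1, finiteDimQuotInf_range_ker hST, h.2, finiteDimQuotInf_range_ker hTS⟩,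
      ⟨S', hS⟩, ⟨T', hT⟩⟩⟩

theorem mul_mem_compactOperator (hST : FiniteDimensional 𝕜 (S ∘L T).range) :
    (S' ∘L S) * (T ∘L T') ∈ compactOperator (RingHom.id 𝕜) X X :=
  have := finiteDimensional_range_mul (S' := S') (T' := T') hST
  mem_compactOperator_of_finiteDimensional_range _

theorem isUnit_calkinLeft_add (Z : Type*) [NormedAddCommGroup Z] [NormedSpace 𝕜 Z]
    (hST : FiniteDimensional 𝕜 (S ∘L T).range)
    (hS : IsGeneralizedInverse S' S) (hT : IsGeneralizedInverse T' T)
    (h : (1 - T ∘L T') * (1 - S' ∘L S) ∈ compactOperator (RingHom.id 𝕜) X X) :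
    IsUnit (calkinLeft Z S' ∘L calkinLeft Z S + calkinLeft Z T ∘L calkinLeft Z T') := by
  rw [calkinLeft_comp, calkinLeft_comp, calkinLeft_add]
  exact isUnit_calkinLeft
    (add_mul_one_sub_sub_one_mem hT.comp_mul_comp_self' (mul_mem_compactOperator hST) h)
    (one_sub_mul_add_sub_one_mem hS.comp_mul_comp_self (mul_mem_compactOperator hST) h)

theorem isUnit_calkinRight_add (Z : Type*) [NormedAddCommGroup Z] [NormedSpace 𝕜 Z]
    (hST : FiniteDimensional 𝕜 (S ∘L T).range)
    (hS : IsGeneralizedInverse S' S) (hT : IsGeneralizedInverse T' T)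
    (h : (1 - T ∘L T') * (1 - S' ∘L S) ∈ compactOperator (RingHom.id 𝕜) X X) :
    IsUnit (calkinRight Z T' ∘L calkinRight Z T + calkinRight Z S ∘L calkinRight Z S') := by
  rw [calkinRight_comp, calkinRight_comp, calkinRight_add, add_comm]
  exact isUnit_calkinRight
    (add_mul_one_sub_sub_one_mem hT.comp_mul_comp_self' (mul_mem_compactOperator hST) h)
    (one_sub_mul_add_sub_one_mem hS.comp_mul_comp_self (mul_mem_compactOperator hST) h)

theorem compl_mul_compl_mem_of_isUnit_calkinLeft {Z : Type*} [NormedAddCommGroup Z]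
    [NormedSpace 𝕜 Z] (e : Z ≃L[𝕜] X) (hST : FiniteDimensional 𝕜 (S ∘L T).range)
    (hS : IsGeneralizedInverse S' S) (hT : IsGeneralizedInverse T' T)
    (h : IsUnit (calkinLeft Z S' ∘L calkinLeft Z S + calkinLeft Z T ∘L calkinLeft Z T')) :
    (1 - T ∘L T') * (1 - S' ∘L S) ∈ compactOperator (RingHom.id 𝕜) X X := by
  rw [calkinLeft_comp, calkinLeft_comp, calkinLeft_add] at h
  obtain ⟨W, hW⟩ := exists_right_inverse_of_isUnit_calkinLeft e h
  exact compl_mul_compl_mem_of_add_mul_sub_one_mem hT.comp_mul_comp_self' hS.comp_mul_comp_self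
    (mul_mem_compactOperator hST) hW

theorem compl_mul_compl_mem_of_isUnit_calkinRight {Z : Type*} [NormedAddCommGroup Z]
    [NormedSpace 𝕜 Z] (e : X ≃L[𝕜] Z) (hST : FiniteDimensional 𝕜 (S ∘L T).range)
    (hS : IsGeneralizedInverse S' S) (hT : IsGeneralizedInverse T' T)
    (h : IsUnit (calkinRight Z T' ∘L calkinRight Z T + calkinRight Z S ∘L calkinRight Z S')) :
    (1 - T ∘L T') * (1 - S' ∘L S) ∈ compactOperator (RingHom.id 𝕜) X X := by
  rw [calkinRight_comp, calkinRight_comp, calkinRight_add, add_comm] at h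
  obtain ⟨W, hW⟩ := exists_left_inverse_of_isUnit_calkinRight e h
  exact compl_mul_compl_mem_of_mul_add_sub_one_mem hT.comp_mul_comp_self' hS.comp_mul_comp_self
    (mul_mem_compactOperator hST) hW

end Pairs

end FredholmPairs

theorem theorem5p5 {𝕜 : Type*} [RCLike 𝕜]
    {X : Type u} [NormedAddCommGroup X] [NormedSpace 𝕜 X] [CompleteSpace X]
    {Y : Type v} [NormedAddCommGroup Y] [NormedSpace 𝕜 Y] [CompleteSpace Y]
    (S : X →L[𝕜] Y) (T : Y →L[𝕜] X)
    (hS : FredholmPairs.IsRegularOperator S) (hT : FredholmPairs.IsRegularOperator T)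
    (hST : FiniteDimensional 𝕜 (S ∘L T).range) (hTS : FiniteDimensional 𝕜 (T ∘L S).range)
    (S' : Y →L[𝕜] X) (T' : X →L[𝕜] Y)
    (hS' : FredholmPairs.IsGeneralizedInverse S' S)
    (hT' : FredholmPairs.IsGeneralizedInverse T' T) :
    (FredholmPairs.IsRegularFredholmPair S T ↔
      ∀ (Z : Type (max u v w)) [NormedAddCommGroup Z] [NormedSpace 𝕜 Z] [CompleteSpace Z],
        IsUnit (FredholmPairs.calkinLeft Z S' ∘L FredholmPairs.calkinLeft Z S +
            FredholmPairs.calkinLeft Z T ∘L FredholmPairs.calkinLeft Z T') ∧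
          IsUnit (FredholmPairs.calkinLeft Z T' ∘L FredholmPairs.calkinLeft Z T +
            FredholmPairs.calkinLeft Z S ∘L FredholmPairs.calkinLeft Z S')) ∧
    (FredholmPairs.IsRegularFredholmPair S T ↔
      ∀ (Z : Type (max u v w)) [NormedAddCommGroup Z] [NormedSpace 𝕜 Z] [CompleteSpace Z],
        IsUnit (FredholmPairs.calkinRight Z S' ∘L FredholmPairs.calkinRight Z S +
            FredholmPairs.calkinRight Z T ∘L FredholmPairs.calkinRight Z T') ∧
          IsUnit (FredholmPairs.calkinRight Z T' ∘L FredholmPairs.calkinRight Z T +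
            FredholmPairs.calkinRight Z S ∘L FredholmPairs.calkinRight Z S')) := by
  have hcompact := FredholmPairs.isRegularFredholmPair_iff_compact hST hTS hS' hT'
  refine ⟨hcompact.trans ⟨fun h Z _ _ _ => ?_, fun h => ?_⟩,
    hcompact.trans ⟨fun h Z _ _ _ => ?_, fun h => ?_⟩⟩
  · exact ⟨FredholmPairs.isUnit_calkinLeft_add Z hST hS' hT' h.1,
      FredholmPairs.isUnit_calkinLeft_add Z hTS hT' hS' h.2⟩
  -- `Z` ranges over a single universe, so the test spaces are lifted copies of `X` and `Y`.
  · exact ⟨FredholmPairs.compl_mul_compl_mem_of_isUnit_calkinLeft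
        (ContinuousLinearEquiv.ulift (R₁ := 𝕜)) hST hS' hT' (h (ULift.{max v w} X)).1,
      FredholmPairs.compl_mul_compl_mem_of_isUnit_calkinLeft
        (ContinuousLinearEquiv.ulift (R₁ := 𝕜)) hTS hT' hS' (h (ULift.{max u w} Y)).2⟩
  -- Right multiplication reverses composition, so the first operator concerns `Y` and the second
  -- `X`.
  · exact ⟨FredholmPairs.isUnit_calkinRight_add Z hTS hT' hS' h.2,
      FredholmPairs.isUnit_calkinRight_add Z hST hS' hT' h.1⟩
  · exact ⟨FredholmPairs.compl_mul_compl_mem_of_isUnit_calkinRight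
        (ContinuousLinearEquiv.ulift (R₁ := 𝕜)).symm hST hS' hT' (h (ULift.{max v w} X)).2,
      FredholmPairs.compl_mul_compl_mem_of_isUnit_calkinRight
        (ContinuousLinearEquiv.ulift (R₁ := 𝕜)).symm hTS hT' hS' (h (ULift.{max u w} Y)).1⟩
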